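/- **Setting.** Let $\mathcal T=(\mathcal V,\mathcal E,\ell)$ be a finite tree with edge lengths $\ell(e)>0$, identified with the compact space obtained by replacing every edge $e$ by a segment of length $\ell(e)$. Let $\mathcal S\subset\mathcal V$ be a set of observed vertices and $d\ge 0$. Let $\mathbb Q$ be a positive (possibly infinite) Borel measure on $C(\mathcal T,\mathbb R^d)$, and for $i\in\mathcal S$ let $\mu_i$ be a Borel probability measure on $\mathbb R^d$. For a measure $\mathbb P$ on $C(\mathcal T,\mathbb R^d)$, write $\mathbb P_i$ and $\mathbb P_{\mathcal S}$ for its images under $\omega\mapsto\omega(i)$ and $\omega\mapsto(\omega(i))_{i\in\mathcal S}$; for a measure $\Pi$ on $(\mathbb R^d)^{\mathcal S}$, write $\Pi_i$ for its $i$-th marginal. For a probability measure $p$ and a positive, $\sigma$-finite, possibly infinite measure $r$, put $\mathrm{KL}(p\Vert r)=\int\log\frac{dp}{dr}\,dp\in[-\infty,\infty]$ if $p\ll r$ and $\int(\log\frac{dp}{dr})^+dp<\infty$, and $\mathrm{KL}(p\Vert r)=+\infty$ otherwise. Consider the problems $$(\mathrm{stat})\quad \min\{\mathrm{KL}(\Pi\Vert\mathbb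 Q_{\mathcal S}) : \Pi\in\mathcal P((\mathbb R^d)^{\mathcal S}),\ \Pi_i=\mu_i\ \ \forall i\in\mathcal S\},$$ $$(\mathrm{dyn})\quad \min\{\mathrm{KL}(\mathbb P\Vert\mathbb Q) : \mathbb P\in\mathcal P(C(\mathcal T,\mathbb R^d)),\ \mathbb P_i=\mu_i\ \ \forall i\in\mathcal S\}.$$ A solution is a minimizer whose relative entropy is $<\infty$. **Lemma (criterion).** Let $B:\mathbb R^d\to[0,\infty)$ be measurable with $\int\exp\big(-\sum_{i\in\mathcal S}B(x_i)\big)\,\mathbb Q_{\mathcal S}(dx_{\mathcal S})<\infty$ and $\int B\,d\mu_i<\infty$ for each $i\in\mathcal S$. Then $\inf(\mathrm{stat})=\inf(\mathrm{dyn})\in(-\infty,\infty]$, and the following are equivalent: (stat) has a solution; (stat) has a unique solution; (dyn) has a solution; (dyn) has a unique solution; $\inf(\mathrm{stat})<\infty$; $\inf(\mathrm{dyn})<\infty$; there is $\Pi^0\in\mathcal P((\mathbb R^d)^{\mathcal S})$ with $\Pi^0_i=\mu_i$ for each $i\in\mathcal S$ and $\mathrm{KL}(\Pi^0\Vert\mathbb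 Q_{\mathcal S})<\infty$. **Proposition (existence).** Let $m$ be a positive $\sigma$-finite measure on $\mathbb R^d$ such that $\mathbb Q_i=m$ for each $i\in\mathcal S$. (a) If (stat) or (dyn) has a solution, then $\mathrm{KL}(\mu_i\Vert m)<\infty$ for each $i\in\mathcal S$. (b) Suppose there are measurable functions $A,B:\mathbb R^d\to[0,\infty)$ such that (i) $\mathbb Q_{\mathcal S}(dx_{\mathcal S})\ge\exp\big(-\sum_{i\in\mathcal S}A(x_i)\big)\,m^{\otimes\mathcal S}(dx_{\mathcal S})$ as measures, (ii) $\int\exp\big(-\sum_{i\in\mathcal S}B(x_i)\big)\,\mathbb Q_{\mathcal S}(dx_{\mathcal S})<\infty$, (iii) $\int(A+B)\,d\mu_i<\infty$ for each $i\in\mathcal S$, (iv) $\mathrm{KL}(\mu_i\Vert m)<\infty$ for each $i\in\mathcal S$. Then (stat) has exactly one solution and (dyn) has exactly one solution. -/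

import Mathlib

open MeasureTheory
open scoped ENNReal NNReal

namespace TreeSB

noncomputable section

/-! ### The continuous tree of a weighted graph -/

section Tree

variable {V : Type*} (G : SimpleGraph V) (len : G.edgeSet → ℝ)

/-- The length of the edge that carries the dart (oriented edge) `a`. -/
def dartLength (a : G.Dart) : ℝ := len ⟨a.edge, a.edge_mem⟩

/-- The pieces before gluing: one point for every vertex, and the segment `[0, len e]` for each of
the two orientations of every edge `e`, with the topology of the disjoint union. -/
abbrev Pieces : Type _ := (Σ _ : V, Unit) ⊕ (Σ a : G.Dart, Set.Icc (0 : ℝ) (dartLength G len a))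

/-- The gluing. The segment of an oriented edge starts at the source of that edge, and the segments
of the two orientations of an edge are identified by reversal. -/
inductive Glue : Pieces G len → Pieces G len → Prop
  | source (a : G.Dart) (t : Set.Icc (0 : ℝ) (dartLength G len a)) (ht : (t : ℝ) = 0) :
      Glue (Sum.inl ⟨a.fst, ()⟩) (Sum.inr ⟨a, t⟩)
  | reverse (a : G.Dart) (s : Set.Icc (0 : ℝ) (dartLength G len a))
      (t : Set.Icc (0 : ℝ) (dartLength G len a.symm)) (h : (s : ℝ) + t = dartLength G len a) :
      Glue (Sum.inr ⟨a, s⟩) (Sum.inr ⟨a.symm, t⟩)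

/-- The space obtained from the weighted graph by replacing each edge `e` by a segment of length
`len e`, with the quotient topology. For a finite graph this is the topology of the path metric. -/
def Realization : Type _ := Quot (Glue G len)

instance : TopologicalSpace (Realization G len) :=
  inferInstanceAs (TopologicalSpace (Quot (Glue G len)))

/-- The point of the realization that corresponds to a vertex. -/
def Realization.vertex (v : V) : Realization G len := Quot.mk _ (Sum.inl ⟨v, ()⟩)

/-- The continuous paths on the realization with values in `ℝ^d`. -/
abbrev Path (d : ℕ) : Type _ := C(Realization G len, EuclideanSpace ℝ (Fin d))

/-- The path space has the Borel σ-algebra of the compact-open topology (for a finite graph, of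
the topology of uniform convergence). -/
instance (d : ℕ) : MeasurableSpace (Path G len d) := borel _

instance (d : ℕ) : BorelSpace (Path G len d) := ⟨rfl⟩

/-- The values of a path at the vertices in `S`. -/
def restrictTo {d : ℕ} (S : Finset V) (ω : Path G len d) : S → EuclideanSpace ℝ (Fin d) :=
  fun i => ω (Realization.vertex G len i)

lemma measurable_restrictTo {d : ℕ} (S : Finset V) :
    Measurable (restrictTo G len S : Path G len d → S → EuclideanSpace ℝ (Fin d)) :=
  measurable_pi_lambda _ fun i =>
    (ContinuousEvalConst.continuous_eval_const (Realization.vertex G len (i : V))).measurable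

end Tree

/-! ### Relative entropy with respect to a possibly infinite measure -/

open scoped Classical in
/-- `KL μ ν = ∫ log (dμ/dν) dμ`, as an extended real number, for a probability measure `μ` and a
σ-finite, possibly infinite, measure `ν`. It is the integral of the positive part minus the integral
of the negative part; it is `+∞` if `μ` is not absolutely continuous with respect to `ν` or if the
integral of the positive part is infinite. (`InformationTheory.klDiv` is meant for finite `ν` and
takes no negative values.) -/
def KL {α : Type*} [MeasurableSpace α] (μ ν : Measure α) : EReal :=
  if μ ≪ ν ∧ ∫⁻ x, ENNReal.ofReal (llr μ ν x) ∂μ < ∞ then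
    ((∫⁻ x, ENNReal.ofReal (llr μ ν x) ∂μ : ℝ≥0∞) : EReal)
      - ((∫⁻ x, ENNReal.ofReal (-llr μ ν x) ∂μ : ℝ≥0∞) : EReal)
  else ⊤

/-- The infimum of `KL · ν` over a set `C` of probability measures. -/
def minValue {α : Type*} [MeasurableSpace α] (ν : Measure α) (C : Set (ProbabilityMeasure α)) :
    EReal :=
  ⨅ P ∈ C, KL (P : Measure α) ν

/-- `P` solves the problem of minimizing `KL · ν` over `C`: it is an element of `C`, its relative
entropy is not `+∞`, and no element of `C` has a smaller one. -/
def IsSolution {α : Type*} [MeasurableSpace α] (ν : Measure α) (C : Set (ProbabilityMeasure α))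
    (P : ProbabilityMeasure α) : Prop :=
  P ∈ C ∧ KL (P : Measure α) ν < ⊤ ∧ ∀ P' ∈ C, KL (P : Measure α) ν ≤ KL (P' : Measure α) ν

/-! ### The static and dynamic problems -/

section Problems

variable {V : Type*} (G : SimpleGraph V) (len : G.edgeSet → ℝ) {d : ℕ} {S : Finset V}

/-- The couplings on `(ℝ^d)^S` with marginals `μ`. -/
def staticConstraint (μ : S → ProbabilityMeasure (EuclideanSpace ℝ (Fin d))) :
    Set (ProbabilityMeasure (S → EuclideanSpace ℝ (Fin d))) :=
  {R | ∀ i, (R : Measure (S → EuclideanSpace ℝ (Fin d))).map (fun x => x i) = μ i}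

/-- The path measures whose marginals at the vertices in `S` are `μ`. -/
def dynamicConstraint (μ : S → ProbabilityMeasure (EuclideanSpace ℝ (Fin d))) :
    Set (ProbabilityMeasure (Path G len d)) :=
  {P | ∀ i : S, (P : Measure (Path G len d)).map (fun ω => ω (Realization.vertex G len i)) = μ i}

end Problems

end

end TreeSB

/-! Let `X` be the observation map, `W = ∑ i, B (x i)`, and let `L` be `Q` weighted by `exp (-W ∘
X)`, a finite measure. The integral of `W ∘ X` against a competitor depends only on its marginals,
so on the constraint set `KL P Q = klDiv P L + c` with a fixed real `c` (`KL_eq_klDiv_weighted`,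
`integrable_sum_marginals`). Both problems thus become minimizations of `klDiv` with a finite
reference.

There the direct method needs no tightness: by a quantitative strict convexity
(`klFun_midpoint_le`), densities of a minimizing sequence are Cauchy in `L¹`. Their limit keeps the
marginals, is optimal by Fatou, and is unique by the same inequality.

The two infima agree: pushing forward by `X` does not increase `klDiv`, and composing a density with
`X` lifts a coupling at equal cost (`exists_lift`).

For (a), finiteness of the entropy passes to images (`KL_map_lt_top`). For (b), the product of the
`μ i` is a competitor of finite entropy (`KL_pi_lt_top`). -/

namespace TreeSB

open InformationTheory Filter
open scoped Topology

/-! ### Minimizers of `klDiv` with respect to a finite reference -/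

section Minimizers

variable {α : Type*} [MeasurableSpace α]

/-- A quantitative form of the strict convexity of `klFun`. -/
lemma klFun_midpoint_le {a b ε : ℝ} (ha : 0 ≤ a) (hb : 0 ≤ b) :
    klFun ((1 / 2) * a + (1 / 2) * b) + ε / 2 * |a - b|
      ≤ (klFun a + klFun b) / 2 + ε ^ 2 / 2 * (a + b) := by
  set m := (1 / 2) * a + (1 / 2) * b with hm
  -- This is `log u ≤ u - 1` at `u = √m / √c`, multiplied by `2 * c`. The square roots make the
  -- convexity gap dominate the Hellinger term `(√a - √b) ^ 2 / 4`.
  have key : ∀ c, 0 ≤ c → c ≤ 2 * m → 2 * c - 2 * (√c * √m) ≤ c * Real.log c - c * Real.log m := by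
    intro c hc hcm
    rcases hc.eq_or_lt with rfl | hc
    · simp
    have hmp : 0 < m := by linarith
    have h := Real.log_le_sub_one_of_pos (div_pos (Real.sqrt_pos.2 hmp) (Real.sqrt_pos.2 hc))
    rw [Real.log_div (Real.sqrt_pos.2 hmp).ne' (Real.sqrt_pos.2 hc).ne', Real.log_sqrt hmp.le,
      Real.log_sqrt hc.le] at h
    have h2 : c * (√m / √c) = √c * √m := by
      have := Real.mul_self_sqrt hc.le
      have hne := (Real.sqrt_pos.2 hc).ne'
      calc c * (√m / √c) = √c * √c * (√m / √c) := by rw [this]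
        _ = √c * √m := by field_simp
    have h3 := mul_le_mul_of_nonneg_left h hc.le
    rw [mul_sub c (√m / √c), h2] at h3
    linarith
  have hka := key a ha (by linarith)
  have hkb := key b hb (by linarith)
  have sa := Real.mul_self_sqrt ha
  have sb := Real.mul_self_sqrt hb
  have sm := Real.mul_self_sqrt (show 0 ≤ m by positivity)
  set x := √a
  set y := √b
  set z := √m
  have hx : 0 ≤ x := Real.sqrt_nonneg _
  have hy : 0 ≤ y := Real.sqrt_nonneg _
  have hz : 0 ≤ z := Real.sqrt_nonneg _
  have hgap : (x - y) ^ 2 / 4 ≤ 2 * m - z * (x + y) := by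
    have h4 : 4 * (z * z) = (x + y) ^ 2 + (x - y) ^ 2 := by rw [sm, hm, ← sa, ← sb]; ring
    have : z * (x + y) ≤ ((x + y) ^ 2 + 4 * (z * z)) / 4 := by
      nlinarith [sq_nonneg (x + y - 2 * z)]
    nlinarith
  -- Young's inequality for `|a - b| = |√a - √b| * (√a + √b)`.
  have habs : ε * |a - b| ≤ (x - y) ^ 2 / 2 + ε ^ 2 * (a + b) := by
    have h5 : a - b = (x - y) * (x + y) := by rw [← sa, ← sb]; ring
    have h6 : |a - b| = |x - y| * (x + y) := by
      rw [h5, abs_mul, abs_of_nonneg (add_nonneg hx hy)]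
    have h7 : (x + y) ^ 2 ≤ 2 * (a + b) := by
      rw [← sa, ← sb]; nlinarith [sq_nonneg (x - y)]
    have h8 : (x - y) ^ 2 = |x - y| ^ 2 := (sq_abs _).symm
    rw [h6, h8]
    nlinarith [sq_nonneg (|x - y| - ε * (x + y)), mul_le_mul_of_nonneg_left h7 (sq_nonneg ε)]
  have hml : m * Real.log m = (1 / 2) * (a * Real.log m) + (1 / 2) * (b * Real.log m) := by
    rw [hm]; ring
  simp only [klFun_apply]
  nlinarith

/-- Integrating the pointwise bound, the two densities have total mass 2, which turns `ε ^ 2 / 2`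
into `ε ^ 2`. The free parameter `ε` is later matched to the distance from the infimum. -/
lemma klDiv_midpoint_le {L P Q R : Measure α} [IsFiniteMeasure L] [IsProbabilityMeasure P]
    [IsProbabilityMeasure Q] (hP : klDiv P L ≠ ∞) (hQ : klDiv Q L ≠ ∞)
    (hR : R = (2⁻¹ : ℝ≥0) • P + (2⁻¹ : ℝ≥0) • Q) {ε : ℝ} (hε : 0 < ε) :
    klDiv R L ≠ ∞ ∧ (klDiv R L).toReal
        + ε / 2 * ∫ x, |(P.rnDeriv L x).toReal - (Q.rnDeriv L x).toReal| ∂L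
      ≤ ((klDiv P L).toReal + (klDiv Q L).toReal) / 2 + ε ^ 2 := by
  obtain ⟨hPL, hPi⟩ := klDiv_ne_top_iff.1 hP
  obtain ⟨hQL, hQi⟩ := klDiv_ne_top_iff.1 hQ
  have : IsFiniteMeasure R := by rw [hR]; infer_instance
  have hRL : R ≪ L := by
    rw [hR]; exact ((hPL.smul_left _).add_left (hQL.smul_left _))
  have hd : ∀ᵐ x ∂L, (R.rnDeriv L x).toReal
      = (1 / 2) * (P.rnDeriv L x).toReal + (1 / 2) * (Q.rnDeriv L x).toReal := by
    rw [hR]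
    filter_upwards [Measure.rnDeriv_add ((2⁻¹ : ℝ≥0) • P) ((2⁻¹ : ℝ≥0) • Q) L,
      Measure.rnDeriv_smul_left P L (2⁻¹ : ℝ≥0), Measure.rnDeriv_smul_left Q L (2⁻¹ : ℝ≥0),
      P.rnDeriv_lt_top L, Q.rnDeriv_lt_top L] with x h1 h2 h3 h4 h5
    rw [h1, Pi.add_apply, h2, h3, Pi.smul_apply, Pi.smul_apply, ENNReal.smul_def,
      ENNReal.smul_def, smul_eq_mul, smul_eq_mul, ENNReal.toReal_add (by finiteness) (by finiteness),
      ENNReal.toReal_mul, ENNReal.toReal_mul]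
    simp
  have iP := (integrable_klFun_rnDeriv_iff hPL).2 hPi
  have iQ := (integrable_klFun_rnDeriv_iff hQL).2 hQi
  have jP : Integrable (fun x => (P.rnDeriv L x).toReal) L := Measure.integrable_toReal_rnDeriv
  have jQ : Integrable (fun x => (Q.rnDeriv L x).toReal) L := Measure.integrable_toReal_rnDeriv
  have hpt : ∀ᵐ x ∂L, klFun (R.rnDeriv L x).toReal
      + ε / 2 * |(P.rnDeriv L x).toReal - (Q.rnDeriv L x).toReal|
      ≤ (klFun (P.rnDeriv L x).toReal + klFun (Q.rnDeriv L x).toReal) / 2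
        + ε ^ 2 / 2 * ((P.rnDeriv L x).toReal + (Q.rnDeriv L x).toReal) := by
    filter_upwards [hd] with x hx
    rw [hx]
    exact klFun_midpoint_le ENNReal.toReal_nonneg ENNReal.toReal_nonneg
  have iRHS := ((iP.add iQ).div_const 2).add ((jP.add jQ).const_mul (ε ^ 2 / 2))
  have iR : Integrable (fun x => klFun (R.rnDeriv L x).toReal) L := by
    refine iRHS.mono' (by
      exact (measurable_klFun.comp (R.measurable_rnDeriv L).ennreal_toReal).aestronglyMeasurable) ?_
    filter_upwards [hpt] with x hx
    rw [Real.norm_of_nonneg (klFun_nonneg ENNReal.toReal_nonneg)]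
    refine le_trans ?_ hx
    have : 0 ≤ ε / 2 * |(P.rnDeriv L x).toReal - (Q.rnDeriv L x).toReal| := by positivity
    linarith
  have hRi := (integrable_klFun_rnDeriv_iff hRL).1 iR
  refine ⟨klDiv_ne_top hRL hRi, ?_⟩
  rw [toReal_klDiv_eq_integral_klFun hRL, toReal_klDiv_eq_integral_klFun hPL,
    toReal_klDiv_eq_integral_klFun hQL]
  have iD := ((jP.sub jQ).abs).const_mul (ε / 2)
  have h := integral_mono_ae (iR.add iD) iRHS hpt
  have e1 := integral_add iR iD
  have e2 := integral_add ((iP.add iQ).div_const 2) ((jP.add jQ).const_mul (ε ^ 2 / 2))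
  have e3 := integral_add iP iQ
  have e4 := integral_add jP jQ
  rw [Measure.integral_toReal_rnDeriv hPL, Measure.integral_toReal_rnDeriv hQL] at e4
  simp only [Pi.add_apply, Pi.sub_apply, integral_const_mul, integral_div,
    probReal_univ] at h e1 e2 e3 e4 ⊢
  rw [e1, e2, e3, e4] at h
  linarith

/-- Probability measures with `L¹`-Cauchy densities converge setwise to a probability measure, along
which `klDiv` is lower semicontinuous. -/
lemma exists_limit_of_cauchy_rnDeriv {L : Measure α} [IsFiniteMeasure L]
    (P : ℕ → ProbabilityMeasure α) (hac : ∀ n, (P n : Measure α) ≪ L) {b : ℕ → ℝ}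
    (hb : Tendsto b atTop (𝓝 0))
    (hcau : ∀ n m N, N ≤ n → N ≤ m →
      ∫ x, |((P n : Measure α).rnDeriv L x).toReal - ((P m : Measure α).rnDeriv L x).toReal| ∂L
        ≤ b N) :
    ∃ R : ProbabilityMeasure α,
      (∀ A, MeasurableSet A →
        Tendsto (fun n => (P n : Measure α) A) atTop (𝓝 ((R : Measure α) A))) ∧
      ∀ I : ℝ≥0∞, Tendsto (fun n => klDiv (P n : Measure α) L) atTop (𝓝 I) →
        klDiv (R : Measure α) L ≤ I := by
  have hi : ∀ n, Integrable (fun x => ((P n : Measure α).rnDeriv L x).toReal) L :=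
    fun n => Measure.integrable_toReal_rnDeriv
  set F : ℕ → (α →₁[L] ℝ) := fun n => (hi n).toL1 _ with hF
  have hFc : CauchySeq F := by
    refine cauchySeq_of_le_tendsto_0 b (fun n m N hn hm => ?_) hb
    refine le_trans (le_of_eq ?_) (hcau n m N hn hm)
    rw [dist_eq_norm, hF, ← Integrable.toL1_sub, L1.norm_eq_integral_norm]
    refine integral_congr_ae ?_
    filter_upwards [((hi n).sub (hi m)).coeFn_toL1] with x hx
    rw [hx]; rfl
  obtain ⟨f, hf⟩ := cauchySeq_tendsto_of_complete hFc
  have hset : ∀ A, MeasurableSet A → Tendsto (fun n => ∫ x in A, F n x ∂L) atTop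
      (𝓝 (∫ x in A, f x ∂L)) := by
    intro A hA
    have := ((continuous_setIntegral (E := ℝ) (μ := L) A).tendsto f).comp hf
    exact this
  -- An almost everywhere convergent subsequence yields the sign of `f`, and pointwise convergence
  -- for Fatou's lemma.
  obtain ⟨ns, hns, hae⟩ := (tendstoInMeasure_of_tendsto_Lp hf).exists_seq_tendsto_ae
  have hae' : ∀ᵐ x ∂L, Tendsto
      (fun i => ((P (ns i) : Measure α).rnDeriv L x).toReal) atTop (𝓝 (f x)) := by
    filter_upwards [hae, ae_all_iff.2 fun n => (hi n).coeFn_toL1] with x hx hx2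
    refine hx.congr fun i => hx2 _
  have hf0 : 0 ≤ᵐ[L] f := by
    filter_upwards [hae'] with x hx
    exact ge_of_tendsto' hx fun i => ENNReal.toReal_nonneg
  have hfi : Integrable f L := L1.integrable_coeFn f
  set R : Measure α := L.withDensity (fun x => ENNReal.ofReal (f x)) with hR
  have hRA : ∀ A, MeasurableSet A → R A = ENNReal.ofReal (∫ x in A, f x ∂L) := by
    intro A hA
    rw [hR, withDensity_apply _ hA,
      ofReal_integral_eq_lintegral_ofReal hfi.integrableOn (ae_restrict_of_ae hf0)]
  have hPA : ∀ n A, MeasurableSet A →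
      (P n : Measure α) A = ENNReal.ofReal (∫ x in A, F n x ∂L) := by
    intro n A hA
    rw [integral_congr_ae (ae_restrict_of_ae (hi n).coeFn_toL1),
      Measure.setIntegral_toReal_rnDeriv (hac n), ofReal_measureReal]
  have hconv : ∀ A, MeasurableSet A → Tendsto (fun n => (P n : Measure α) A) atTop (𝓝 (R A)) := by
    intro A hA
    rw [hRA A hA]
    simp_rw [fun n => hPA n A hA]
    exact (ENNReal.continuous_ofReal.tendsto _).comp (hset A hA)
  have hRp : IsProbabilityMeasure R := by
    refine ⟨tendsto_nhds_unique (hconv _ MeasurableSet.univ) ?_⟩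
    simp
  refine ⟨⟨R, hRp⟩, hconv, fun I hI => ?_⟩
  have hRL : R ≪ L := withDensity_absolutelyContinuous _ _
  have hRd : R.rnDeriv L =ᵐ[L] fun x => ENNReal.ofReal (f x) :=
    Measure.rnDeriv_withDensity₀ _ hfi.aemeasurable.ennreal_ofReal
  change klDiv R L ≤ I
  rw [klDiv_eq_lintegral_klFun_of_ac hRL]
  calc ∫⁻ x, ENNReal.ofReal (klFun (R.rnDeriv L x).toReal) ∂L
      = ∫⁻ x, liminf (fun i => ENNReal.ofReal
          (klFun ((P (ns i) : Measure α).rnDeriv L x).toReal)) atTop ∂L := by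
        refine lintegral_congr_ae ?_
        filter_upwards [hae', hRd, hf0] with x h1 h2 h3
        rw [h2, ENNReal.toReal_ofReal h3]
        exact (((ENNReal.continuous_ofReal.comp continuous_klFun).tendsto _).comp h1).liminf_eq.symm
    _ ≤ liminf (fun i => ∫⁻ x, ENNReal.ofReal
          (klFun ((P (ns i) : Measure α).rnDeriv L x).toReal) ∂L) atTop :=
        lintegral_liminf_le fun i => (measurable_klFun.comp
          (Measure.measurable_rnDeriv _ L).ennreal_toReal).ennreal_ofReal
    _ = I := by
        simp_rw [← fun i => klDiv_eq_lintegral_klFun_of_ac (hac (ns i))]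
        exact (hI.comp hns.tendsto_atTop).liminf_eq

/-- A set of probability measures that is stable under midpoints and under setwise limits. -/
structure IsMidpointClosed (C : Set (ProbabilityMeasure α)) : Prop where
  midpoint : ∀ P ∈ C, ∀ Q ∈ C, ∀ R : ProbabilityMeasure α,
    (R : Measure α) = (2⁻¹ : ℝ≥0) • (P : Measure α) + (2⁻¹ : ℝ≥0) • (Q : Measure α) → R ∈ C
  limit : ∀ (P : ℕ → ProbabilityMeasure α) (R : ProbabilityMeasure α), (∀ n, P n ∈ C) →
    (∀ A, MeasurableSet A →
      Tendsto (fun n => (P n : Measure α) A) atTop (𝓝 ((R : Measure α) A))) → R ∈ C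

lemma exists_midpoint (P Q : ProbabilityMeasure α) : ∃ R : ProbabilityMeasure α,
    (R : Measure α) = (2⁻¹ : ℝ≥0) • (P : Measure α) + (2⁻¹ : ℝ≥0) • (Q : Measure α) := by
  refine ⟨⟨_, ⟨?_⟩⟩, rfl⟩
  simp only [Measure.add_apply, Measure.smul_apply, measure_univ, ENNReal.smul_def, smul_eq_mul,
    mul_one]
  rw [ENNReal.coe_inv two_ne_zero]
  exact ENNReal.inv_two_add_inv_two

/-- The midpoint costs at least `I` while the endpoints cost at most `I + ε ^ 2`, so `ε / 2` times
the distance is at most `2 * ε ^ 2`. -/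
lemma IsMidpointClosed.integral_abs_sub_le {C : Set (ProbabilityMeasure α)}
    (hC : IsMidpointClosed C) {L : Measure α} [IsFiniteMeasure L] {I ε : ℝ} (hε : 0 < ε)
    (hI : ∀ R ∈ C, klDiv (R : Measure α) L ≠ ∞ → I ≤ (klDiv (R : Measure α) L).toReal)
    {P Q : ProbabilityMeasure α} (hP : P ∈ C) (hQ : Q ∈ C)
    (hP' : klDiv (P : Measure α) L ≠ ∞) (hQ' : klDiv (Q : Measure α) L ≠ ∞)
    (hPI : (klDiv (P : Measure α) L).toReal ≤ I + ε ^ 2)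
    (hQI : (klDiv (Q : Measure α) L).toReal ≤ I + ε ^ 2) :
    ∫ x, |((P : Measure α).rnDeriv L x).toReal - ((Q : Measure α).rnDeriv L x).toReal| ∂L
      ≤ 4 * ε := by
  obtain ⟨R, hR⟩ := exists_midpoint P Q
  obtain ⟨h1, h2⟩ := klDiv_midpoint_le hP' hQ' hR hε
  have h3 := hI R (hC.midpoint P hP Q hQ R hR) h1
  have h4 : ε / 2 * ∫ x, |((P : Measure α).rnDeriv L x).toReal
      - ((Q : Measure α).rnDeriv L x).toReal| ∂L ≤ ε / 2 * (4 * ε) := by nlinarith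
  exact le_of_mul_le_mul_left h4 (by positivity)

/-- Two minimizers are within `ε ^ 2` of the minimum for every `ε > 0`, so their densities are at
`L¹` distance zero. -/
lemma IsMidpointClosed.eq_of_klDiv_le {C : Set (ProbabilityMeasure α)}
    (hC : IsMidpointClosed C) {L : Measure α} [IsFiniteMeasure L]
    {P Q : ProbabilityMeasure α} (hP : P ∈ C) (hQ : Q ∈ C)
    (hP' : klDiv (P : Measure α) L ≠ ∞) (hQ' : klDiv (Q : Measure α) L ≠ ∞)
    (hPm : ∀ R ∈ C, klDiv (P : Measure α) L ≤ klDiv (R : Measure α) L)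
    (hQm : ∀ R ∈ C, klDiv (Q : Measure α) L ≤ klDiv (R : Measure α) L) : P = Q := by
  have hle : ∀ ε : ℝ, 0 < ε → ∫ x, |((P : Measure α).rnDeriv L x).toReal
      - ((Q : Measure α).rnDeriv L x).toReal| ∂L ≤ 4 * ε := by
    intro ε hε
    refine hC.integral_abs_sub_le (I := (klDiv (P : Measure α) L).toReal) hε
      (fun R hR hR' => ENNReal.toReal_mono hR' (hPm R hR)) hP hQ hP' hQ' ?_ ?_
    · nlinarith
    · have := ENNReal.toReal_mono hP' (hQm P hP)
      nlinarith
  have h0 : ∫ x, |((P : Measure α).rnDeriv L x).toReal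
      - ((Q : Measure α).rnDeriv L x).toReal| ∂L = 0 := by
    refine le_antisymm (le_of_forall_pos_le_add fun ε hε => ?_)
      (integral_nonneg fun x => abs_nonneg _)
    have := hle (ε / 4) (by positivity)
    linarith
  have hPL := (klDiv_ne_top_iff.1 hP').1
  have hQL := (klDiv_ne_top_iff.1 hQ').1
  have h0 := (integral_eq_zero_iff_of_nonneg (fun x => abs_nonneg _)
    ((Measure.integrable_toReal_rnDeriv.sub Measure.integrable_toReal_rnDeriv).abs)).1 h0
  apply Subtype.ext
  change (P : Measure α) = Q
  rw [← Measure.withDensity_rnDeriv_eq _ _ hPL, ← Measure.withDensity_rnDeriv_eq _ _ hQL]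
  refine withDensity_congr_ae ?_
  filter_upwards [h0, (P : Measure α).rnDeriv_lt_top L, (Q : Measure α).rnDeriv_lt_top L]
    with x hx h1 h2
  exact (ENNReal.toReal_eq_toReal_iff' h1.ne h2.ne).1 (sub_eq_zero.1 (abs_eq_zero.1 hx))

theorem IsMidpointClosed.exists_klDiv_le {C : Set (ProbabilityMeasure α)}
    (hC : IsMidpointClosed C) {L : Measure α} [IsFiniteMeasure L]
    (hne : ∃ P ∈ C, klDiv (P : Measure α) L ≠ ∞) :
    ∃ P ∈ C, klDiv (P : Measure α) L ≠ ∞ ∧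
      ∀ R ∈ C, klDiv (P : Measure α) L ≤ klDiv (R : Measure α) L := by
  set J : ℝ≥0∞ := ⨅ P ∈ C, klDiv (P : Measure α) L with hJ
  have hJle : ∀ P ∈ C, J ≤ klDiv (P : Measure α) L := fun P hP => iInf₂_le P hP
  have hJt : J ≠ ∞ := by
    obtain ⟨P, hP, h⟩ := hne
    exact ne_top_of_le_ne_top h (hJle P hP)
  -- The slack is the square of `ε = 1 / (n + 1)`, giving the Cauchy rate `4 / (N + 1)`.
  have hex : ∀ n : ℕ, ∃ P ∈ C,
      klDiv (P : Measure α) L < J + ENNReal.ofReal ((1 / ((n : ℝ) + 1)) ^ 2) := by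
    intro n
    have hlt : J < J + ENNReal.ofReal ((1 / ((n : ℝ) + 1)) ^ 2) :=
      ENNReal.lt_add_right hJt (by
        rw [Ne, ENNReal.ofReal_eq_zero, not_le]; positivity)
    simpa only [iInf_lt_iff, exists_prop] using hJ.symm.trans_lt hlt
  choose P hPC hPlt using hex
  have hPt : ∀ n, klDiv (P n : Measure α) L ≠ ∞ := fun n => (hPlt n).ne_top
  have hPr : ∀ n, (klDiv (P n : Measure α) L).toReal ≤ J.toReal + (1 / ((n : ℝ) + 1)) ^ 2 := by
    intro n
    have := ENNReal.toReal_mono (by finiteness) (hPlt n).le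
    rwa [ENNReal.toReal_add hJt (by finiteness), ENNReal.toReal_ofReal (by positivity)] at this
  have hPN : ∀ n N : ℕ, N ≤ n →
      (klDiv (P n : Measure α) L).toReal ≤ J.toReal + (1 / ((N : ℝ) + 1)) ^ 2 := by
    intro n N h
    refine (hPr n).trans ?_
    have : 1 / ((n : ℝ) + 1) ≤ 1 / ((N : ℝ) + 1) := by gcongr
    gcongr
  have hlim0 : Tendsto (fun n : ℕ => 1 / ((n : ℝ) + 1)) atTop (𝓝 0) :=
    tendsto_one_div_add_atTop_nhds_zero_nat
  obtain ⟨R, hR, hRle⟩ := exists_limit_of_cauchy_rnDeriv (L := L) P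
    (fun n => (klDiv_ne_top_iff.1 (hPt n)).1) (b := fun N => 4 * (1 / ((N : ℝ) + 1)))
    (by simpa using hlim0.const_mul 4)
    (fun n m N hn hm => hC.integral_abs_sub_le (I := J.toReal) (by positivity)
      (fun R hR hR' => ENNReal.toReal_mono hR' (hJle R hR)) (hPC n) (hPC m) (hPt n) (hPt m)
      (hPN n N hn) (hPN m N hm))
  have hRC := hC.limit P R hPC hR
  have hRJ : klDiv (R : Measure α) L ≤ J := by
    refine hRle J (tendsto_of_tendsto_of_tendsto_of_le_of_le tendsto_const_nhds ?_
      (fun n => hJle _ (hPC n)) fun n => (hPlt n).le)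
    have h2 : Tendsto (fun n : ℕ => ENNReal.ofReal ((1 / ((n : ℝ) + 1)) ^ 2)) atTop (𝓝 0) := by
      have := (ENNReal.continuous_ofReal.tendsto 0).comp
        (show Tendsto (fun n : ℕ => (1 / ((n : ℝ) + 1)) ^ 2) atTop (𝓝 0) by
          simpa using hlim0.pow 2)
      rw [ENNReal.ofReal_zero] at this
      exact this
    simpa using h2.const_add J
  exact ⟨R, hRC, ne_top_of_le_ne_top hJt hRJ, fun Q hQ => hRJ.trans (hJle Q hQ)⟩

end Minimizers

/-! ### Relative entropy with respect to an infinite reference -/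

section Entropy

variable {α : Type*} [MeasurableSpace α]

/-- Only the positive part matters here: an infinite negative part gives `⊥`, which is still below
`⊤`. -/
lemma KL_lt_top_iff {μ ν : Measure α} :
    KL μ ν < ⊤ ↔ μ ≪ ν ∧ ∫⁻ x, ENNReal.ofReal (llr μ ν x) ∂μ < ∞ := by
  unfold KL
  split_ifs with h
  · refine iff_of_true ?_ h
    rw [sub_eq_add_neg]
    refine EReal.add_lt_top (by simpa using h.2.ne) ?_
    rw [Ne, EReal.neg_eq_top_iff]
    exact EReal.coe_ennreal_ne_bot _
  · exact iff_of_false (lt_irrefl _) h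

/-- With `p` the density, `p * log p ≥ p - 1` gives `-p * log p ≤ 1`. For finite `L` the negative
part is therefore always integrable. -/
lemma lintegral_ofReal_neg_llr_le {P L : Measure α} [SigmaFinite P] [SigmaFinite L] (h : P ≪ L) :
    ∫⁻ x, ENNReal.ofReal (-llr P L x) ∂P ≤ L Set.univ := by
  have hm : Measurable fun x => ENNReal.ofReal (-llr P L x) := (measurable_llr P L).neg.ennreal_ofReal
  rw [← lintegral_rnDeriv_mul h hm.aemeasurable, ← lintegral_one]
  refine lintegral_mono_ae ?_
  filter_upwards [P.rnDeriv_lt_top L] with x hx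
  rcases eq_or_ne (P.rnDeriv L x) 0 with h0 | h0
  · simp [h0]
  have hpos := ENNReal.toReal_pos h0 hx.ne
  rw [← ENNReal.ofReal_toReal hx.ne, ← ENNReal.ofReal_mul hpos.le, ← ENNReal.ofReal_one]
  refine ENNReal.ofReal_le_ofReal ?_
  rw [llr_def]
  have := Real.one_sub_inv_le_log_of_pos hpos
  have h2 := mul_le_mul_of_nonneg_left this hpos.le
  rw [mul_sub, mul_inv_cancel₀ hpos.ne'] at h2
  nlinarith

lemma integrable_llr_iff_lintegral_lt_top {P L : Measure α} [SigmaFinite P] [IsFiniteMeasure L]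
    (h : P ≪ L) : Integrable (llr P L) P ↔ ∫⁻ x, ENNReal.ofReal (llr P L x) ∂P < ∞ := by
  refine ⟨fun hi => hi.lintegral_lt_top, fun hi => ⟨(measurable_llr P L).aestronglyMeasurable, ?_⟩⟩
  rw [hasFiniteIntegral_iff_norm]
  calc ∫⁻ x, ENNReal.ofReal ‖llr P L x‖ ∂P
      ≤ ∫⁻ x, (ENNReal.ofReal (llr P L x) + ENNReal.ofReal (-llr P L x)) ∂P := by
        refine lintegral_mono fun x => ?_
        rcases le_total 0 (llr P L x) with hx | hx
        · rw [Real.norm_of_nonneg hx]; exact le_self_add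
        · rw [Real.norm_of_nonpos hx]; exact le_add_self
    _ = ∫⁻ x, ENNReal.ofReal (llr P L x) ∂P + ∫⁻ x, ENNReal.ofReal (-llr P L x) ∂P :=
        lintegral_add_left (measurable_llr P L).ennreal_ofReal _
    _ < ∞ := ENNReal.add_lt_top.2 ⟨hi,
        (lintegral_ofReal_neg_llr_le h).trans_lt (measure_lt_top L _)⟩

lemma KL_eq_integral {P Q : Measure α} (h : P ≪ Q) (hi : Integrable (llr P Q) P) :
    KL P Q = ((∫ x, llr P Q x ∂P : ℝ) : EReal) := by
  have h1 : ∫⁻ x, ENNReal.ofReal (llr P Q x) ∂P < ∞ := hi.lintegral_lt_top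
  have h2 : ∫⁻ x, ENNReal.ofReal (-llr P Q x) ∂P < ∞ := hi.neg.lintegral_lt_top
  rw [KL, if_pos ⟨h, h1⟩, integral_eq_lintegral_pos_part_sub_lintegral_neg_part hi,
    EReal.coe_sub, EReal.coe_ennreal_toReal h1.ne, EReal.coe_ennreal_toReal h2.ne]

/-- The measure with density `exp (-W)`. -/
noncomputable def weighted (Q : Measure α) (W : α → ℝ) : Measure α :=
  Q.withDensity fun x => ENNReal.ofReal (Real.exp (-W x))

lemma weighted_apply_univ (Q : Measure α) (W : α → ℝ) :
    weighted Q W Set.univ = ∫⁻ x, ENNReal.ofReal (Real.exp (-W x)) ∂Q := by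
  rw [weighted, withDensity_apply _ MeasurableSet.univ, Measure.restrict_univ]

lemma absolutelyContinuous_weighted {Q : Measure α} {W : α → ℝ} (hW : Measurable W) :
    Q ≪ weighted Q W :=
  withDensity_absolutelyContinuous' (by fun_prop)
    (ae_of_all _ fun x => by simp [Real.exp_pos])

lemma weighted_absolutelyContinuous (Q : Measure α) (W : α → ℝ) : weighted Q W ≪ Q :=
  withDensity_absolutelyContinuous _ _

/-- The finite inverse weight recovers `Q` from a finite measure. This supplies the σ-finiteness
that the Radon–Nikodym calculus needs. -/
lemma sigmaFinite_of_weighted {Q : Measure α} {W : α → ℝ} (hW : Measurable W)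
    [IsFiniteMeasure (weighted Q W)] : SigmaFinite Q := by
  have hm : Measurable fun x => ENNReal.ofReal (Real.exp (-W x)) := by fun_prop
  have h : Q = (weighted Q W).withDensity (fun x => (ENNReal.ofReal (Real.exp (-W x)))⁻¹) := by
    rw [weighted, withDensity_inv_same hm]
    · exact ae_of_all _ fun x => by simp [Real.exp_pos]
    · exact ae_of_all _ fun x => ENNReal.ofReal_ne_top
  rw [h]
  exact SigmaFinite.withDensity_of_ne_top (ae_of_all _ fun x => by simp [Real.exp_pos])

lemma llr_weighted {P Q : Measure α} [SigmaFinite P] [SigmaFinite Q] {W : α → ℝ}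
    (hW : Measurable W) (h : P ≪ Q) :
    llr P (weighted Q W) =ᵐ[P] fun x => llr P Q x + W x := by
  have h1 := h.ae_le (Measure.rnDeriv_withDensity_right P Q
    (f := fun x => ENNReal.ofReal (Real.exp (-W x))) (by fun_prop)
    (ae_of_all _ fun x => by simp [Real.exp_pos]) (ae_of_all _ fun x => ENNReal.ofReal_ne_top))
  filter_upwards [h1, Measure.rnDeriv_pos h, h.ae_le (P.rnDeriv_lt_top Q)] with x hx hpos hlt
  replace hpos := ENNReal.toReal_pos hpos.ne' hlt.ne
  have hx' : P.rnDeriv (weighted Q W) x = _ := hx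
  simp only [llr_def]
  rw [hx', ENNReal.toReal_mul, ENNReal.toReal_inv, ENNReal.toReal_ofReal (Real.exp_pos _).le,
    Real.log_mul (by positivity) hpos.ne', Real.log_inv, Real.log_exp]
  ring

/-- Relative entropy with respect to a reference that becomes finite under the weight `exp (-W)`. -/
lemma KL_eq_klDiv_weighted {P Q : Measure α} [IsProbabilityMeasure P] {W : α → ℝ}
    (hW : Measurable W) (hWi : Integrable W P) [IsFiniteMeasure (weighted Q W)] :
    KL P Q = (klDiv P (weighted Q W) : EReal)
      + ((1 - (weighted Q W).real Set.univ - ∫ x, W x ∂P : ℝ) : EReal) := by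
  have := sigmaFinite_of_weighted (Q := Q) hW
  by_cases h : P ≪ Q
  swap
  · have h' : ¬ P ≪ weighted Q W := fun hc => h (hc.trans (weighted_absolutelyContinuous Q W))
    rw [KL, if_neg (fun hc => h hc.1), klDiv_of_not_ac h']
    rw [EReal.coe_ennreal_top, EReal.top_add_coe]
  have hPL := h.trans (absolutelyContinuous_weighted hW)
  have hl := llr_weighted hW h
  by_cases hi : Integrable (llr P (weighted Q W)) P
  · have hiQ : Integrable (llr P Q) P := by
      refine (hi.sub hWi).congr ?_
      filter_upwards [hl] with x hx
      simp [hx]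
    -- `klDiv` is the integral of `llr` plus the mass of the reference minus that of `P`; this is
    -- the source of `1 - (weighted Q W).real Set.univ`.
    rw [KL_eq_integral h hiQ, ← ENNReal.ofReal_toReal (klDiv_ne_top hPL hi),
      toReal_klDiv hPL hi, probReal_univ (μ := P), integral_congr_ae hl, integral_add hiQ hWi]
    rw [EReal.coe_ennreal_ofReal, max_eq_left]
    · rw [← EReal.coe_add]
      congr 1
      ring
    · have := integral_llr_add_sub_measure_univ_nonneg hPL hi
      rwa [probReal_univ (μ := P), integral_congr_ae hl, integral_add hiQ hWi] at this
  · rw [klDiv_of_not_integrable hi, KL, if_neg]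
    · rw [EReal.coe_ennreal_top, EReal.top_add_coe]
    · rintro ⟨-, hc⟩
      refine hi ((integrable_llr_iff_lintegral_lt_top hPL).2 ?_)
      calc ∫⁻ x, ENNReal.ofReal (llr P (weighted Q W) x) ∂P
          ≤ ∫⁻ x, (ENNReal.ofReal (llr P Q x) + ENNReal.ofReal (W x)) ∂P := by
            refine lintegral_mono_ae ?_
            filter_upwards [hl] with x hx
            rw [hx]
            exact ENNReal.ofReal_add_le
        _ = ∫⁻ x, ENNReal.ofReal (llr P Q x) ∂P + ∫⁻ x, ENNReal.ofReal (W x) ∂P :=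
            lintegral_add_left (measurable_llr P Q).ennreal_ofReal _
        _ < ∞ := ENNReal.add_lt_top.2 ⟨hc, hWi.lintegral_lt_top⟩

/-- The positive part of the relative entropy stays finite under a map. -/
lemma KL_map_lt_top {β : Type*} [MeasurableSpace β] {P Q : Measure α} [IsProbabilityMeasure P]
    {X : α → β} (hX : Measurable X) [SigmaFinite (Q.map X)] (h : KL P Q < ⊤) :
    KL (P.map X) (Q.map X) < ⊤ := by
  have := SigmaFinite.of_map Q hX.aemeasurable inferInstance
  have := Measure.isProbabilityMeasure_map (μ := P) hX.aemeasurable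
  obtain ⟨hac, hfin⟩ := KL_lt_top_iff.1 h
  have hac' := hac.map hX
  refine KL_lt_top_iff.2 ⟨hac', ?_⟩
  set g := (P.map X).rnDeriv (Q.map X) with hg
  have hgm : Measurable g := Measure.measurable_rnDeriv _ _
  -- Here `a` is the density of `P` and `b` that of the image, at `X x`. If `b > a`, then `log b ≤
  -- log a + b / a`; the error `b` integrates to the mass of the image of `P`.
  have hpt : ∀ a b : ℝ, 0 ≤ a → 0 ≤ b → a * max (Real.log b) 0 ≤ a * max (Real.log a) 0 + b := by
    intro a b ha hb
    rcases le_or_gt b a with hba | hab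
    · rcases hb.eq_or_lt with rfl | hb
      · simp; positivity
      · have := Real.log_le_log hb hba
        have : a * max (Real.log b) 0 ≤ a * max (Real.log a) 0 := by gcongr
        linarith
    · rcases ha.eq_or_lt with rfl | ha
      · simpa using hb
      · have hb' := ha.trans hab
        have h1 := Real.log_le_sub_one_of_pos (div_pos hb' ha)
        rw [Real.log_div hb'.ne' ha.ne'] at h1
        have h2 : max (Real.log b) 0 ≤ max (Real.log a) 0 + b / a := by
          refine max_le ?_ (by positivity)
          have := le_max_left (Real.log a) 0
          linarith
        have h3 := mul_le_mul_of_nonneg_left h2 ha.le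
        rwa [mul_add, mul_div_cancel₀ _ ha.ne'] at h3
  calc ∫⁻ y, ENNReal.ofReal (llr (P.map X) (Q.map X) y) ∂(P.map X)
      = ∫⁻ x, ENNReal.ofReal (llr (P.map X) (Q.map X) (X x)) ∂P :=
        lintegral_map (measurable_llr _ _).ennreal_ofReal hX
    _ = ∫⁻ x, P.rnDeriv Q x * ENNReal.ofReal (llr (P.map X) (Q.map X) (X x)) ∂Q :=
        (lintegral_rnDeriv_mul hac
          ((measurable_llr _ _).comp hX).ennreal_ofReal.aemeasurable).symm
    _ ≤ ∫⁻ x, (P.rnDeriv Q x * ENNReal.ofReal (llr P Q x) + g (X x)) ∂Q := by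
        refine lintegral_mono_ae ?_
        have h1 := ae_of_ae_map hX.aemeasurable ((P.map X).rnDeriv_lt_top (Q.map X))
        filter_upwards [h1, P.rnDeriv_lt_top Q] with x hx hx2
        have := hpt _ _ (ENNReal.toReal_nonneg (a := P.rnDeriv Q x))
          (ENNReal.toReal_nonneg (a := g (X x)))
        have := ENNReal.ofReal_le_ofReal this
        rw [ENNReal.ofReal_add (by positivity) (by positivity), ENNReal.ofReal_mul (by positivity),
          ENNReal.ofReal_mul (by positivity), ENNReal.ofReal_max, ENNReal.ofReal_max,
          ENNReal.ofReal_toReal hx.ne, ENNReal.ofReal_toReal hx2.ne] at this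
        simpa [llr_def] using this
    _ = ∫⁻ x, ENNReal.ofReal (llr P Q x) ∂P + ∫⁻ x, g (X x) ∂Q := by
        have hgX : Measurable fun x => g (X x) := hgm.comp hX
        rw [lintegral_add_right _ hgX,
          lintegral_rnDeriv_mul hac (measurable_llr P Q).ennreal_ofReal.aemeasurable]
    _ < ∞ := by
        refine ENNReal.add_lt_top.2 ⟨hfin, ?_⟩
        rw [← lintegral_map hgm hX, hg, Measure.lintegral_rnDeriv hac']
        exact measure_lt_top _ _

end Entropy

/-! ### Marginal constraints, lifting, and the solvability criterion -/

section Reduction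

variable {α β : Type*} [MeasurableSpace α] [MeasurableSpace β]

lemma weighted_map {Q : Measure α} {X : α → β} (hX : Measurable X) {W : β → ℝ}
    (hW : Measurable W) : (weighted Q fun x => W (X x)).map X = weighted (Q.map X) W := by
  ext A hA
  rw [Measure.map_apply hX hA, weighted, weighted, withDensity_apply _ hA,
    withDensity_apply _ (hX hA), setLIntegral_map hA (by fun_prop) hX]

/-- A measure on the target of `X` lifts, by composing its density with `X`, to a measure with the
same divergence. -/
lemma exists_lift {L : Measure α} [IsFiniteMeasure L] {X : α → β} (hX : Measurable X)
    (R : ProbabilityMeasure β) (h : (R : Measure β) ≪ L.map X) :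
    ∃ P : ProbabilityMeasure α, (P : Measure α).map X = R ∧
      klDiv (P : Measure α) L = klDiv (R : Measure β) (L.map X) := by
  set g := (R : Measure β).rnDeriv (L.map X) with hg
  have hgm : Measurable g := Measure.measurable_rnDeriv _ _
  have hgX : Measurable fun x => g (X x) := hgm.comp hX
  set P : Measure α := L.withDensity fun x => g (X x) with hP
  have hmap : P.map X = R := by
    rw [← Measure.withDensity_rnDeriv_eq _ _ h]
    ext A hA
    rw [Measure.map_apply hX hA, hP, withDensity_apply _ (hX hA), withDensity_apply _ hA,
      setLIntegral_map hA hgm hX]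
  have hprob : IsProbabilityMeasure P :=
    ⟨by rw [← Set.preimage_univ (f := X), ← Measure.map_apply hX MeasurableSet.univ, hmap,
      measure_univ]⟩
  refine ⟨⟨P, hprob⟩, hmap, ?_⟩
  change klDiv P L = _
  rw [klDiv_eq_lintegral_klFun_of_ac (withDensity_absolutelyContinuous _ _),
    klDiv_eq_lintegral_klFun_of_ac h, lintegral_map (by
      exact (measurable_klFun.comp hgm.ennreal_toReal).ennreal_ofReal) hX]
  refine lintegral_congr_ae ?_
  filter_upwards [Measure.rnDeriv_withDensity L hgX] with x hx
  rw [hx]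

/-- Each constraint prescribes the masses of preimages, so it is affine and survives setwise limits.
-/
lemma isMidpointClosed_marginals {ι : Type*} {Y : ι → α → β} (hY : ∀ i, Measurable (Y i))
    (μ : ι → ProbabilityMeasure β) :
    IsMidpointClosed {P : ProbabilityMeasure α | ∀ i, (P : Measure α).map (Y i) = μ i} where
  midpoint P hP Q hQ R hR i := by
    rw [hR, Measure.map_add _ _ (hY i), Measure.map_smul, Measure.map_smul, hP i, hQ i]
    ext A _
    simp only [Measure.add_apply, Measure.smul_apply, ENNReal.smul_def, smul_eq_mul]
    rw [← add_mul, ENNReal.coe_inv two_ne_zero]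
    simp [ENNReal.inv_two_add_inv_two]
  limit P R hP hR i := by
    ext A hA
    rw [Measure.map_apply (hY i) hA]
    refine tendsto_nhds_unique (hR _ (hY i hA)) ?_
    simp_rw [fun n => (Measure.map_apply (μ := (P n : Measure α)) (hY i) hA).symm.trans
      (by rw [hP n i])]
    exact tendsto_const_nhds

lemma coe_add_coe_lt_top_iff {a : ℝ≥0∞} {c : ℝ} : (a : EReal) + (c : EReal) < ⊤ ↔ a ≠ ∞ := by
  refine ⟨fun h ha => ?_, fun h => EReal.add_lt_top (by simpa using h) (EReal.coe_ne_top c)⟩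
  rw [ha, EReal.coe_ennreal_top, EReal.top_add_coe] at h
  exact lt_irrefl _ h

lemma coe_add_coe_le_iff {a b : ℝ≥0∞} {c : ℝ} :
    (a : EReal) + (c : EReal) ≤ (b : EReal) + (c : EReal) ↔ a ≤ b := by
  rw [(EReal.addLECancellable_coe c).add_le_add_iff_right, EReal.coe_ennreal_le_coe_ennreal_iff]

lemma le_minValue {Q L : Measure α} {C : Set (ProbabilityMeasure α)} {c : ℝ}
    (hKL : ∀ P ∈ C, KL (P : Measure α) Q = (klDiv (P : Measure α) L : EReal) + (c : EReal)) :
    (c : EReal) ≤ minValue Q C := by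
  refine le_iInf₂ fun P hP => ?_
  rw [hKL P hP]
  exact le_add_of_nonneg_left (EReal.coe_ennreal_nonneg _)

lemma minValue_lt_top_iff {Q : Measure α} {C : Set (ProbabilityMeasure α)} :
    minValue Q C < ⊤ ↔ ∃ P ∈ C, KL (P : Measure α) Q < ⊤ := by
  simp only [minValue, iInf_lt_iff, exists_prop]

/-- Adding a real constant changes neither the minimizers nor the finiteness of the value. -/
lemma IsMidpointClosed.existsUnique_isSolution {Q L : Measure α} [IsFiniteMeasure L]
    {C : Set (ProbabilityMeasure α)} (hC : IsMidpointClosed C) {c : ℝ}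
    (hKL : ∀ P ∈ C, KL (P : Measure α) Q = (klDiv (P : Measure α) L : EReal) + (c : EReal))
    (h : minValue Q C < ⊤) : ∃! P, IsSolution Q C P := by
  have hiff : ∀ P, IsSolution Q C P ↔ P ∈ C ∧ klDiv (P : Measure α) L ≠ ∞ ∧
      ∀ R ∈ C, klDiv (P : Measure α) L ≤ klDiv (R : Measure α) L := by
    intro P
    refine and_congr_right fun hP => and_congr ?_ (forall₂_congr fun R hR => ?_)
    · rw [hKL P hP, coe_add_coe_lt_top_iff]
    · rw [hKL P hP, hKL R hR, coe_add_coe_le_iff]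
  obtain ⟨P₀, hP₀, hlt⟩ := minValue_lt_top_iff.1 h
  rw [hKL P₀ hP₀, coe_add_coe_lt_top_iff] at hlt
  obtain ⟨P, hP⟩ := hC.exists_klDiv_le ⟨P₀, hP₀, hlt⟩
  refine ⟨P, (hiff P).2 hP, fun R hR => ?_⟩
  obtain ⟨h1, h2, h3⟩ := (hiff R).1 hR
  exact hC.eq_of_klDiv_le h1 hP.1 h2 hP.2.1 h3 hP.2.2

lemma IsSolution.minValue_lt_top {Q : Measure α} {C : Set (ProbabilityMeasure α)}
    {P : ProbabilityMeasure α} (h : IsSolution Q C P) : minValue Q C < ⊤ :=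
  minValue_lt_top_iff.2 ⟨P, h.1, h.2.1⟩

/-- This makes the additive constant in the entropy formula common to all competitors. -/
lemma integrable_sum_marginals {ι : Type*} [Fintype ι] {Y : ι → α → β}
    (hY : ∀ i, Measurable (Y i)) {μ : ι → ProbabilityMeasure β} {B : β → ℝ≥0} (hB : Measurable B)
    (hBμ : ∀ i, ∫⁻ x, (B x : ℝ≥0∞) ∂(μ i : Measure β) < ∞) {P : ProbabilityMeasure α}
    (hP : ∀ i, (P : Measure α).map (Y i) = μ i) :
    Integrable (fun x => ∑ i, (B (Y i x) : ℝ)) (P : Measure α) ∧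
      ∫ x, ∑ i, (B (Y i x) : ℝ) ∂(P : Measure α) = ∑ i, ∫ y, (B y : ℝ) ∂(μ i : Measure β) := by
  have hBi : ∀ i, Integrable (fun y => (B y : ℝ)) (μ i : Measure β) := by
    intro i
    refine ⟨hB.coe_nnreal_real.aestronglyMeasurable, ?_⟩
    rw [hasFiniteIntegral_iff_ofReal (ae_of_all _ fun y => (B y).coe_nonneg)]
    simpa using hBμ i
  have hi : ∀ i, Integrable (fun x => (B (Y i x) : ℝ)) (P : Measure α) := by
    intro i
    have := hBi i
    rw [← hP i] at this
    exact this.comp_measurable (hY i)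
  refine ⟨integrable_finsetSum _ fun i _ => hi i, ?_⟩
  rw [integral_finsetSum _ fun i _ => hi i]
  refine Finset.sum_congr rfl fun i _ => ?_
  rw [← hP i, integral_map (hY i).aemeasurable hB.coe_nnreal_real.aestronglyMeasurable]

/-- The solvability criterion, for a reference measure `Q` on any measurable space and finitely
many observed coordinates. -/
theorem minValue_eq_and_tfae_isSolution {ι : Type*} [Fintype ι] {X : α → ι → β}
    (hX : Measurable X) (Q : Measure α) (μ : ι → ProbabilityMeasure β) {B : β → ℝ≥0}
    (hB : Measurable B)
    (hfin : ∫⁻ x, ENNReal.ofReal (Real.exp (-∑ i, (B (x i) : ℝ))) ∂(Q.map X) < ∞)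
    (hBμ : ∀ i, ∫⁻ x, (B x : ℝ≥0∞) ∂(μ i : Measure β) < ∞)
    {C : Set (ProbabilityMeasure (ι → β))}
    (hCdef : C = {R : ProbabilityMeasure (ι → β) | ∀ i,
      (R : Measure (ι → β)).map (fun x => x i) = μ i})
    {D : Set (ProbabilityMeasure α)}
    (hDdef : D = {P : ProbabilityMeasure α | ∀ i, (P : Measure α).map (fun ω => X ω i) = μ i}) :
    minValue (Q.map X) C = minValue Q D ∧ ⊥ < minValue (Q.map X) C ∧
      List.TFAE [∃ R, IsSolution (Q.map X) C R, ∃! R, IsSolution (Q.map X) C R,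
        ∃ P, IsSolution Q D P, ∃! P, IsSolution Q D P,
        minValue (Q.map X) C < ⊤, minValue Q D < ⊤,
        ∃ R₀ ∈ C, KL (R₀ : Measure (ι → β)) (Q.map X) < ⊤] := by
  set W : (ι → β) → ℝ := fun x => ∑ i, (B (x i) : ℝ) with hWdef
  have hW : Measurable W :=
    Finset.measurable_sum _ fun i _ => (hB.comp (measurable_pi_apply i)).coe_nnreal_real
  have hWX : Measurable fun x => W (X x) := hW.comp hX
  have hXi : ∀ i, Measurable fun ω => X ω i := fun i => (measurable_pi_apply i).comp hX
  set L := weighted Q fun x => W (X x) with hL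
  have hmap : L.map X = weighted (Q.map X) W := weighted_map hX hW
  have hLS : IsFiniteMeasure (weighted (Q.map X) W) := ⟨by rw [weighted_apply_univ]; exact hfin⟩
  have hmass : weighted (Q.map X) W Set.univ = L Set.univ := by
    rw [← hmap, Measure.map_apply hX MeasurableSet.univ, Set.preimage_univ]
  have hLf : IsFiniteMeasure L := ⟨by rw [← hmass]; exact measure_lt_top _ _⟩
  -- The same `c` serves both problems, since `L` and its image under `X` have equal mass.
  set c : ℝ := 1 - L.real Set.univ - ∑ i, ∫ y, (B y : ℝ) ∂(μ i : Measure β) with hc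
  have hKLC : ∀ R ∈ C, KL (R : Measure (ι → β)) (Q.map X)
      = (klDiv (R : Measure (ι → β)) (weighted (Q.map X) W) : EReal) + (c : EReal) := by
    intro R hR
    rw [hCdef] at hR
    obtain ⟨h1, h2⟩ := integrable_sum_marginals (Y := fun i (x : ι → β) => x i)
      (fun i => measurable_pi_apply i) hB hBμ hR
    rw [KL_eq_klDiv_weighted hW h1, h2, measureReal_def, hmass, hc, measureReal_def]
  have hKLD : ∀ P ∈ D, KL (P : Measure α) Q = (klDiv (P : Measure α) L : EReal) + (c : EReal) := by
    intro P hP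
    rw [hDdef] at hP
    obtain ⟨h1, h2⟩ := integrable_sum_marginals (Y := fun i ω => X ω i) hXi hB hBμ hP
    rw [KL_eq_klDiv_weighted hWX h1, h2, hc]
  have hCc : IsMidpointClosed C :=
    hCdef ▸ isMidpointClosed_marginals (Y := fun i (x : ι → β) => x i)
      (fun i => measurable_pi_apply i) μ
  have hDc : IsMidpointClosed D := hDdef ▸ isMidpointClosed_marginals hXi μ
  -- Data processing along `X`; the reverse inequality lifts each coupling, those not absolutely
  -- continuous having value `⊤`.
  have hle : minValue (Q.map X) C ≤ minValue Q D := by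
    refine le_iInf₂ fun P hP => ?_
    set R : ProbabilityMeasure (ι → β) := P.map hX.aemeasurable with hR
    have hRm : (R : Measure (ι → β)) = (P : Measure α).map X := rfl
    have hRC : R ∈ C := by
      rw [hCdef]
      intro i
      rw [hDdef] at hP
      rw [hRm, Measure.map_map (measurable_pi_apply i) hX]
      exact hP i
    refine (iInf₂_le R hRC).trans ?_
    rw [hKLC R hRC, hKLD P hP, coe_add_coe_le_iff, hRm, ← hmap]
    exact klDiv_map_le _ _ hX
  have hge : minValue Q D ≤ minValue (Q.map X) C := by
    refine le_iInf₂ fun R hR => ?_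
    by_cases hac : (R : Measure (ι → β)) ≪ L.map X
    · obtain ⟨P, hPm, hPk⟩ := exists_lift hX R hac
      have hPD : P ∈ D := by
        rw [hDdef]
        intro i
        rw [hCdef] at hR
        rw [← hR i, ← hPm, Measure.map_map (measurable_pi_apply i) hX]
        rfl
      refine (iInf₂_le P hPD).trans ?_
      rw [hKLC R hR, hKLD P hPD, coe_add_coe_le_iff, hPk, hmap]
    · rw [hKLC R hR, ← hmap, klDiv_of_not_ac hac, EReal.coe_ennreal_top, EReal.top_add_coe]
      exact le_top
  have heq := le_antisymm hle hge
  refine ⟨heq, (EReal.bot_lt_coe c).trans_le (le_minValue hKLC), ?_⟩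
  tfae_have 2 → 1 := fun h => h.exists
  tfae_have 4 → 3 := fun h => h.exists
  tfae_have 1 → 5 := fun ⟨R, hR⟩ => hR.minValue_lt_top
  tfae_have 3 → 6 := fun ⟨P, hP⟩ => hP.minValue_lt_top
  tfae_have 5 → 2 := hCc.existsUnique_isSolution hKLC
  tfae_have 6 → 4 := hDc.existsUnique_isSolution hKLD
  tfae_have 5 ↔ 6 := by rw [heq]
  tfae_have 5 ↔ 7 := minValue_lt_top_iff
  tfae_finish

end Reduction

/-! ### The product of the marginals as a competitor -/

section Product

variable {E : Type*} [MeasurableSpace E]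

/-- It suffices to compare on boxes, where the density times the indicator factors over the
coordinates. -/
lemma pi_eq_withDensity_prod {ι : Type*} [Fintype ι] (μ : ι → Measure E) (m : Measure E)
    [∀ i, IsProbabilityMeasure (μ i)] [SigmaFinite m] (h : ∀ i, μ i ≪ m) :
    Measure.pi μ = (Measure.pi fun _ : ι => m).withDensity
      (fun x => ENNReal.ofReal (∏ i, ((μ i).rnDeriv m (x i)).toReal)) := by
  refine Measure.pi_eq (μ := μ) fun s hs => ?_
  have hg : ∀ i, Integrable ((s i).indicator fun y => ((μ i).rnDeriv m y).toReal) m :=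
    fun i => Measure.integrable_toReal_rnDeriv.indicator (hs i)
  have hind : ∀ x : ι → E, (Set.univ.pi s).indicator
      (fun x => ENNReal.ofReal (∏ i, ((μ i).rnDeriv m (x i)).toReal)) x
      = ENNReal.ofReal (∏ i, (s i).indicator (fun y => ((μ i).rnDeriv m y).toReal) (x i)) := by
    intro x
    by_cases hx : x ∈ Set.univ.pi s
    · rw [Set.indicator_of_mem hx]
      congr 1
      refine Finset.prod_congr rfl fun i _ => ?_
      rw [Set.indicator_of_mem (hx i (Set.mem_univ i))]
    · rw [Set.indicator_of_notMem hx]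
      obtain ⟨i, hi⟩ : ∃ i, x i ∉ s i := by simpa [Set.mem_pi] using hx
      rw [Finset.prod_eq_zero (Finset.mem_univ i) (Set.indicator_of_notMem hi _),
        ENNReal.ofReal_zero]
  have hms : MeasurableSet (Set.univ.pi s) := MeasurableSet.univ_pi hs
  rw [withDensity_apply _ hms, ← lintegral_indicator hms, lintegral_congr hind,
    ← ofReal_integral_eq_lintegral_ofReal (Integrable.fintype_prod hg)
      (ae_of_all _ fun x => Finset.prod_nonneg fun i _ =>
        Set.indicator_nonneg (fun _ _ => ENNReal.toReal_nonneg) _),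
    integral_fintype_prod_eq_prod, ENNReal.ofReal_prod_of_nonneg
      (fun i _ => integral_nonneg fun x => Set.indicator_nonneg (fun _ _ => ENNReal.toReal_nonneg) _)]
  refine Finset.prod_congr rfl fun i _ => ?_
  rw [integral_indicator (hs i), Measure.setIntegral_toReal_rnDeriv (h i), ofReal_measureReal]

/-- The logarithm of the product splits because every factor is positive almost everywhere for the
product measure. -/
lemma llr_pi {ι : Type*} [Fintype ι] (μ : ι → Measure E) (m : Measure E)
    [∀ i, IsProbabilityMeasure (μ i)] [SigmaFinite m] (h : ∀ i, μ i ≪ m) :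
    llr (Measure.pi μ) (Measure.pi fun _ : ι => m) =ᵐ[Measure.pi μ]
      fun x => ∑ i, llr (μ i) m (x i) := by
  have hpi := pi_eq_withDensity_prod μ m h
  have hac : Measure.pi μ ≪ Measure.pi fun _ : ι => m := by
    rw [hpi]; exact withDensity_absolutelyContinuous _ _
  have hd := Measure.rnDeriv_withDensity (Measure.pi fun _ : ι => m)
    (f := fun x => ENNReal.ofReal (∏ i, ((μ i).rnDeriv m (x i)).toReal))
    (Measurable.ennreal_ofReal (Finset.measurable_prod _ fun i _ =>
      ((Measure.measurable_rnDeriv (μ i) m).comp (measurable_pi_apply i)).ennreal_toReal))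
  rw [← hpi] at hd
  have hpos : ∀ i, ∀ᵐ x ∂Measure.pi μ, 0 < ((μ i).rnDeriv m (x i)).toReal := by
    intro i
    refine (measurePreserving_eval μ i).quasiMeasurePreserving.ae
      (p := fun y => 0 < ((μ i).rnDeriv m y).toReal) ?_
    filter_upwards [Measure.rnDeriv_pos (h i), (h i).ae_le ((μ i).rnDeriv_lt_top m)] with y h1 h2
    exact ENNReal.toReal_pos h1.ne' h2.ne
  filter_upwards [hac.ae_le hd, ae_all_iff.2 hpos] with x hx hp
  rw [llr_def]
  simp only
  rw [hx, ENNReal.toReal_ofReal (Finset.prod_nonneg fun i _ => (hp i).le),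
    Real.log_prod fun i _ => (hp i).ne']
  rfl

/-- By the chain rule, `dP/dQ = dP/dR * dR/dQ`, and the last factor is at most 1. -/
lemma llr_le_of_le {α : Type*} [MeasurableSpace α] {P R Q : Measure α} [SigmaFinite P]
    [SigmaFinite R] [SigmaFinite Q] (hPR : P ≪ R) (hRQ : R ≤ Q) :
    ∀ᵐ x ∂P, llr P Q x ≤ llr P R x := by
  have hPQ := hPR.trans hRQ.absolutelyContinuous
  filter_upwards [hPQ.ae_le (Measure.rnDeriv_mul_rnDeriv (κ := Q) hPR),
    hPQ.ae_le (Measure.rnDeriv_le_one_of_le hRQ), Measure.rnDeriv_pos hPQ,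
    hPR.ae_le (P.rnDeriv_lt_top R)] with x h1 h2 h3 h4
  have hle : P.rnDeriv Q x ≤ P.rnDeriv R x := by
    rw [← h1, Pi.mul_apply]
    exact mul_le_of_le_one_right' h2
  exact Real.log_le_log (ENNReal.toReal_pos h3.ne' (hle.trans_lt h4).ne)
    (ENNReal.toReal_mono h4.ne hle)

/-- The lower bound on `Q` gives `llr (Measure.pi μ) Q x ≤ ∑ i, (llr (μ i) m (x i) + A (x i))`
almost everywhere. Positive parts are subadditive, and each summand integrates against its own
marginal. -/
lemma KL_pi_lt_top {ι : Type*} [Fintype ι] (μ : ι → Measure E) (m : Measure E)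
    [∀ i, IsProbabilityMeasure (μ i)] [SigmaFinite m] (hμ : ∀ i, KL (μ i) m < ⊤)
    {A : E → ℝ≥0} (hA : Measurable A) (hAμ : ∀ i, ∫⁻ x, (A x : ℝ≥0∞) ∂(μ i) < ∞)
    {Q : Measure (ι → E)} [SigmaFinite Q]
    (hQ : weighted (Measure.pi fun _ : ι => m) (fun x => ∑ i, (A (x i) : ℝ)) ≤ Q) :
    KL (Measure.pi μ) Q < ⊤ := by
  have hac : ∀ i, μ i ≪ m := fun i => (KL_lt_top_iff.1 (hμ i)).1
  have hW : Measurable fun x : ι → E => ∑ i, (A (x i) : ℝ) :=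
    Finset.measurable_sum _ fun i _ => (hA.comp (measurable_pi_apply i)).coe_nnreal_real
  have hpac : Measure.pi μ ≪ Measure.pi fun _ : ι => m := by
    rw [pi_eq_withDensity_prod μ m hac]; exact withDensity_absolutelyContinuous _ _
  have hwac := hpac.trans (absolutelyContinuous_weighted hW)
  have : SigmaFinite (weighted (Measure.pi fun _ : ι => m) (fun x => ∑ i, (A (x i) : ℝ))) :=
    SigmaFinite.withDensity_of_ne_top (ae_of_all _ fun x => ENNReal.ofReal_ne_top)
  refine KL_lt_top_iff.2 ⟨hwac.trans hQ.absolutelyContinuous, ?_⟩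
  have hmi : ∀ i, Measurable fun y => ENNReal.ofReal (llr (μ i) m y) + (A y : ℝ≥0∞) :=
    fun i => (measurable_llr _ _).ennreal_ofReal.add hA.coe_nnreal_ennreal
  calc ∫⁻ x, ENNReal.ofReal (llr (Measure.pi μ) Q x) ∂Measure.pi μ
      ≤ ∫⁻ x, ∑ i, (ENNReal.ofReal (llr (μ i) m (x i)) + (A (x i) : ℝ≥0∞)) ∂Measure.pi μ := by
        refine lintegral_mono_ae ?_
        filter_upwards [llr_le_of_le hwac hQ, llr_weighted hW hpac, llr_pi μ m hac] with x h1 h2 h3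
        refine (ENNReal.ofReal_le_ofReal h1).trans ?_
        rw [h2, h3, ← Finset.sum_add_distrib]
        refine (Finset.le_sum_of_subadditive ENNReal.ofReal ENNReal.ofReal_zero.le
          (fun _ _ => ENNReal.ofReal_add_le) _ _).trans (Finset.sum_le_sum fun i _ => ?_)
        refine ENNReal.ofReal_add_le.trans ?_
        rw [ENNReal.ofReal_coe_nnreal]
    _ = ∑ i, ∫⁻ x, (ENNReal.ofReal (llr (μ i) m (x i)) + (A (x i) : ℝ≥0∞)) ∂Measure.pi μ :=
        lintegral_finsetSum _ fun i _ => (hmi i).comp (measurable_pi_apply i)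
    _ = ∑ i, ∫⁻ y, (ENNReal.ofReal (llr (μ i) m y) + (A y : ℝ≥0∞)) ∂(μ i) :=
        Finset.sum_congr rfl fun i _ => (measurePreserving_eval μ i).lintegral_comp (hmi i)
    _ < ∞ := by
        refine ENNReal.sum_lt_top.2 fun i _ => ?_
        rw [lintegral_add_left (measurable_llr _ _).ennreal_ofReal]
        exact ENNReal.add_lt_top.2 ⟨(KL_lt_top_iff.1 (hμ i)).2, hAμ i⟩

end Product

end TreeSB

/-! ### The tree theorem -/

open TreeSB in
theorem mainTheorem6 {V : Type*} [Finite V] (G : SimpleGraph V) (hG : G.IsTree)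
    (len : G.edgeSet → ℝ) (hlen : ∀ e, 0 < len e) (S : Finset V) (d : ℕ)
    (Q : Measure (TreeSB.Path G len d))
    (μ : S → ProbabilityMeasure (EuclideanSpace ℝ (Fin d))) :
    -- the criterion for solvability
    (∀ B : EuclideanSpace ℝ (Fin d) → ℝ≥0, Measurable B →
      ∫⁻ x, ENNReal.ofReal (Real.exp (-∑ i, (B (x i) : ℝ)))
        ∂(Q.map (TreeSB.restrictTo G len S)) < ∞ →
      (∀ i, ∫⁻ x, (B x : ℝ≥0∞) ∂(μ i : Measure (EuclideanSpace ℝ (Fin d))) < ∞) →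
      TreeSB.minValue (Q.map (TreeSB.restrictTo G len S)) (TreeSB.staticConstraint μ)
          = TreeSB.minValue Q (TreeSB.dynamicConstraint G len μ) ∧
      ⊥ < TreeSB.minValue (Q.map (TreeSB.restrictTo G len S)) (TreeSB.staticConstraint μ) ∧
      List.TFAE [
        ∃ R, TreeSB.IsSolution (Q.map (TreeSB.restrictTo G len S))
          (TreeSB.staticConstraint μ) R,
        ∃! R, TreeSB.IsSolution (Q.map (TreeSB.restrictTo G len S))
          (TreeSB.staticConstraint μ) R,
        ∃ P, TreeSB.IsSolution Q (TreeSB.dynamicConstraint G len μ) P,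
        ∃! P, TreeSB.IsSolution Q (TreeSB.dynamicConstraint G len μ) P,
        TreeSB.minValue (Q.map (TreeSB.restrictTo G len S)) (TreeSB.staticConstraint μ) < ⊤,
        TreeSB.minValue Q (TreeSB.dynamicConstraint G len μ) < ⊤,
        ∃ R₀ ∈ TreeSB.staticConstraint μ,
          TreeSB.KL (R₀ : Measure (S → EuclideanSpace ℝ (Fin d)))
            (Q.map (TreeSB.restrictTo G len S)) < ⊤]) ∧
    -- the reference has marginal `m` at every observed vertex
    (∀ (m : Measure (EuclideanSpace ℝ (Fin d))) [SigmaFinite m],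
      (∀ i : S, Q.map (fun ω => ω (TreeSB.Realization.vertex G len i)) = m) →
      -- (a) necessity
      (((∃ R, TreeSB.IsSolution (Q.map (TreeSB.restrictTo G len S))
            (TreeSB.staticConstraint μ) R) ∨
          (∃ P, TreeSB.IsSolution Q (TreeSB.dynamicConstraint G len μ) P)) →
        ∀ i, TreeSB.KL (μ i : Measure (EuclideanSpace ℝ (Fin d))) m < ⊤) ∧
      -- (b) sufficiency
      (∀ A B : EuclideanSpace ℝ (Fin d) → ℝ≥0, Measurable A → Measurable B →
        (Measure.pi fun _ : S => m).withDensity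
            (fun x => ENNReal.ofReal (Real.exp (-∑ i, (A (x i) : ℝ))))
          ≤ Q.map (TreeSB.restrictTo G len S) →
        ∫⁻ x, ENNReal.ofReal (Real.exp (-∑ i, (B (x i) : ℝ)))
          ∂(Q.map (TreeSB.restrictTo G len S)) < ∞ →
        (∀ i, ∫⁻ x, ((A x + B x : ℝ≥0) : ℝ≥0∞)
          ∂(μ i : Measure (EuclideanSpace ℝ (Fin d))) < ∞) →
        (∀ i, TreeSB.KL (μ i : Measure (EuclideanSpace ℝ (Fin d))) m < ⊤) →
        (∃! R, TreeSB.IsSolution (Q.map (TreeSB.restrictTo G len S))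
          (TreeSB.staticConstraint μ) R) ∧
        (∃! P, TreeSB.IsSolution Q (TreeSB.dynamicConstraint G len μ) P))) := by
  have hX := measurable_restrictTo G len S (d := d)
  have hXi : ∀ i : S, Measurable fun ω : TreeSB.Path G len d => restrictTo G len S ω i :=
    fun i => (measurable_pi_apply i).comp hX
  have hcrit := fun (B : EuclideanSpace ℝ (Fin d) → ℝ≥0) (hB : Measurable B) hfin hBμ =>
    minValue_eq_and_tfae_isSolution hX Q μ hB hfin hBμ (C := staticConstraint μ) rfl
      (D := dynamicConstraint G len μ) rfl
  refine ⟨hcrit, fun m _ hm => ⟨?_, ?_⟩⟩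
  · intro h i
    have hmi : (Q.map (restrictTo G len S)).map (fun x => x i) = m := by
      rw [Measure.map_map (measurable_pi_apply i) hX]
      exact hm i
    rcases h with ⟨R, hR⟩ | ⟨P, hP⟩
    -- The image entropy bound needs only the one-coordinate image of `Q` to be σ-finite, and that
    -- image is `m`.
    · have hsf : SigmaFinite ((Q.map (restrictTo G len S)).map (fun x => x i)) := by
        rw [hmi]; infer_instance
      have := KL_map_lt_top (measurable_pi_apply i) hR.2.1
      rwa [hR.1 i, hmi] at this
    · have hsf : SigmaFinite (Q.map fun ω => restrictTo G len S ω i) := by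
        rw [show (Q.map fun ω => restrictTo G len S ω i) = m from hm i]; infer_instance
      have := KL_map_lt_top (hXi i) hP.2.1
      rwa [show ((P : Measure (TreeSB.Path G len d)).map fun ω => restrictTo G len S ω i) = μ i from hP.1 i,
        show (Q.map fun ω => restrictTo G len S ω i) = m from hm i] at this
  · intro A B hA hB hlow hfin hAB hμ
    have hAμ : ∀ i, ∫⁻ x, (A x : ℝ≥0∞) ∂(μ i : Measure (EuclideanSpace ℝ (Fin d))) < ∞ :=
      fun i => (lintegral_mono fun x => by push_cast; exact le_self_add).trans_lt (hAB i)
    have hBμ : ∀ i, ∫⁻ x, (B x : ℝ≥0∞) ∂(μ i : Measure (EuclideanSpace ℝ (Fin d))) < ∞ :=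
      fun i => (lintegral_mono fun x => by push_cast; exact le_add_self).trans_lt (hAB i)
    obtain ⟨-, -, htfae⟩ := hcrit B hB hfin hBμ
    have hfinite : IsFiniteMeasure (weighted (Q.map (restrictTo G len S))
        fun x => ∑ i, (B (x i) : ℝ)) := ⟨by rw [weighted_apply_univ]; exact hfin⟩
    have hsf : SigmaFinite (Q.map (restrictTo G len S)) :=
      sigmaFinite_of_weighted (W := fun x => ∑ i, (B (x i) : ℝ)) (Finset.measurable_sum _ fun i _ =>
        (hB.comp (measurable_pi_apply i)).coe_nnreal_real)
    let ν : S → Measure (EuclideanSpace ℝ (Fin d)) := fun i => μ i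
    have hν : ∀ i, IsProbabilityMeasure (ν i) := fun i => inferInstanceAs
      (IsProbabilityMeasure (μ i : Measure (EuclideanSpace ℝ (Fin d))))
    have hprod : ∃ R₀ ∈ staticConstraint μ, KL (R₀ : Measure (S → EuclideanSpace ℝ (Fin d)))
        (Q.map (restrictTo G len S)) < ⊤ :=
      ⟨⟨Measure.pi ν, inferInstance⟩,
      fun i => (measurePreserving_eval ν i).map_eq,
      KL_pi_lt_top ν m hμ hA hAμ hlow⟩
    -- Indices count from 0: 1 and 3 are the two unique solvability statements, 6 is the
    -- finite-entropy competitor.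
    exact ⟨(htfae.out 1 6).2 hprod, (htfae.out 3 6).2 hprod⟩
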